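/- Let $\mathcal H$ be a complex Hilbert space with inner product $\langle\cdot,\cdot\rangle$ linear in the first variable. A *resolution of the identity* of $\mathcal H$ on $\mathbb R$ is a family $\{X(\lambda)\}_{\lambda\in\mathbb R}$ of bounded (not necessarily self-adjoint) operators on $\mathcal H$ such that - $\gamma(X):=\sup_{\lambda}\|X(\lambda)\|<\infty$; - $X(\lambda)X(\mu)=X(\mu)X(\lambda)=X(\lambda)$ whenever $\lambda<\mu$; - $\lim_{\lambda\to-\infty}X(\lambda)\xi=0$ and $\lim_{\lambda\to+\infty}X(\lambda)\xi=\xi$ for every $\xi\in\mathcal H$; - $\lim_{\epsilon\to0^+}X(\lambda+\epsilon)\xi=X(\lambda)\xi$ for every $\lambda\in\mathbb R$ and $\xi\in\mathcal H$. It is a *$*$-resolution of the identity* if $\{X(\lambda)^*\}_{\lambda\in\mathbb R}$ is a resolution of the identity too. **Theorem.** Let $\{X(\lambda)\}_{\lambda\in\mathbb R}$ be a $*$-resolution of the identity of $\mathcal H$ with $\gamma(X)=1$, and put $\Phi(\lambda)=(X(\lambda)^*X(\lambda))^{1/2}$. Then for all $\xi,\eta\in\mathcal H$ the function $\lambda\mapsto\langle\Phi(\lambda)\xi,\xi\rangle$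 is increasing and the function $\lambda\mapsto\langle\Phi(\lambda)\xi,\eta\rangle$ is of bounded variation on $\mathbb R$, so that they define a positive, respectively complex, Lebesgue–Stieltjes measure, denoted $d\langle\Phi(\lambda)\xi,\xi\rangle$, respectively $d\langle\Phi(\lambda)\xi,\eta\rangle$. Set $$D(S_X)=\Big\{\xi\in\mathcal H:\ \int_{\mathbb R}\lambda^2\,d\langle\Phi(\lambda)\xi,\xi\rangle<\infty\Big\}.$$ Then $D(S_X)$ is a dense linear subspace of $\mathcal H$, and there exists a unique closed symmetric operator $S_X$ with domain exactly $D(S_X)$ such that, for all $\xi\in D(S_X)$ and $\eta\in\mathcal H$, the function $\lambda\mapsto\lambda$ is integrable with respect to the total variation of $d\langle\Phi(\lambda)\xi,\eta\rangle$ and $$\langle S_X\xi,\eta\rangle=\int_{\mathbb R}\lambda\,d\langle\Phi(\lambda)\xi,\eta\rangle.$$ -/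

import Mathlib

open Filter Topology MeasureTheory
open scoped ENNReal

/-- A resolution of the identity of the complex Hilbert space `H` on the real line: a uniformly
bounded family of (not necessarily self-adjoint) bounded operators with
`X(l) X(m) = X(m) X(l) = X(l)` for `l < m`, strong limits `0` and `1` at `-∞` and `+∞`, and
strongly continuous from the right. -/
structure IsResolutionOfIdentity {H : Type*} [NormedAddCommGroup H] [InnerProductSpace ℂ H]
    (X : ℝ → H →L[ℂ] H) : Prop where
  bounded : BddAbove (Set.range fun l => ‖X l‖)
  mul_eq_left : ∀ l m : ℝ, l < m → X l * X m = X l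
  mul_eq_right : ∀ l m : ℝ, l < m → X m * X l = X l
  tendsto_atBot : ∀ ξ : H, Tendsto (fun l => X l ξ) atBot (𝓝 0)
  tendsto_atTop : ∀ ξ : H, Tendsto (fun l => X l ξ) atTop (𝓝 ξ)
  right_continuous : ∀ (l : ℝ) (ξ : H), Tendsto (fun m => X m ξ) (𝓝[>] l) (𝓝 (X l ξ))

/-- A `*`-resolution of the identity: both `X(l)` and `X(l)*` form a resolution of the
identity. -/
structure IsStarResolutionOfIdentity {H : Type*} [NormedAddCommGroup H] [InnerProductSpace ℂ H]
    [CompleteSpace H] (X : ℝ → H →L[ℂ] H) : Prop where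
  resolution : IsResolutionOfIdentity X
  adjoint_resolution : IsResolutionOfIdentity fun l => ContinuousLinearMap.adjoint (X l)

/-- The constant `γ(X) = sup_l ‖X(l)‖`. -/
noncomputable def resolutionBound {H : Type*} [NormedAddCommGroup H] [InnerProductSpace ℂ H]
    (X : ℝ → H →L[ℂ] H) : ℝ :=
  ⨆ l : ℝ, ‖X l‖

/-- `Φ(l) = (X(l)* X(l))^{1/2}`, the positive square root of a positive bounded operator. -/
noncomputable def resolutionAbs {H : Type*} [NormedAddCommGroup H] [InnerProductSpace ℂ H]
    [CompleteSpace H] (X : ℝ → H →L[ℂ] H) (l : ℝ) : H →L[ℂ] H :=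
  CFC.sqrt (ContinuousLinearMap.adjoint (X l) * X l)

/-- The complex function `l ↦ ⟨Φ(l) ξ, η⟩`, where `⟨·, ·⟩` is linear in its first argument, so that
it is `inner ℂ η (Φ(l) ξ)` in Mathlib's convention. -/
noncomputable def resolutionForm {H : Type*} [NormedAddCommGroup H] [InnerProductSpace ℂ H]
    [CompleteSpace H] (X : ℝ → H →L[ℂ] H) (ξ η : H) (l : ℝ) : ℂ :=
  inner ℂ η (resolutionAbs X l ξ)

/-- The real function `l ↦ ⟨Φ(l) ξ, ξ⟩`. -/
noncomputable def resolutionQuadForm {H : Type*} [NormedAddCommGroup H] [InnerProductSpace ℂ H]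
    [CompleteSpace H] (X : ℝ → H →L[ℂ] H) (ξ : H) (l : ℝ) : ℝ :=
  (resolutionForm X ξ ξ l).re

/-! ### Contractive idempotents are orthogonal projections. -/

section Projection

variable {H : Type*} [NormedAddCommGroup H] [InnerProductSpace ℂ H] [CompleteSpace H]

/-! Right continuity makes each `X l` idempotent, and `γ(X) = 1` makes it contractive, hence an
orthogonal projection. So `Φ = X` is an ordinary spectral family `E`, and the operator is `∫ l dE`,
which is even self-adjoint. For fixed `ξ`, let `μ_ξ` be the Stieltjes measure of `‖E l ξ‖²`. The
indicators of `(-∞, t]` in `L²(μ_ξ)` and the vectors `E t ξ` have the same Gram matrix, which gives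
an isometry `lpMap` from `L²(μ_ξ)` into `H`. Its adjoint at `η`, conjugated, is the density of `d⟨E
ξ, η⟩` with respect to `μ_ξ`; bounded variation and the integral formula follow. The operator sends
`ξ` to the image of the function `l`, when that function is in `L²(μ_ξ)`. This isometry depends on
`ξ`, so linearity and symmetry come from `exists_stepOp_tendsto`: real combinations of the `E t`
approximate the operator on finitely many vectors at once. The spectral projections of `(-n, n]`
give density of the domain and self-adjointness, hence closedness. -/

/-- A contractive idempotent operator on a Hilbert space is self-adjoint. -/
lemma IsIdempotentElem.isSelfAdjoint_of_norm_le_one {P : H →L[ℂ] H} (hP : IsIdempotentElem P)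
    (hn : ‖P‖ ≤ 1) : IsSelfAdjoint P := by
  have key : ContinuousLinearMap.adjoint P * P = P := by
    ext x
    have hPx : P (P x) = P x := congrArg (fun T : H →L[ℂ] H => T x) hP
    have h1 : ‖ContinuousLinearMap.adjoint P (P x)‖ ≤ ‖P x‖ :=
      ((ContinuousLinearMap.adjoint P).le_of_opNorm_le
        ((ContinuousLinearMap.adjoint.norm_map P).trans_le hn) _).trans_eq (one_mul _)
    -- By idempotence the cross term `⟨P* P x, P x⟩` is `‖P x‖²`, so the square equals `‖P* P x‖² -
    -- ‖P x‖²`.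
    have h2 : ‖ContinuousLinearMap.adjoint P (P x) - P x‖ ^ 2 ≤ 0 := by
      rw [@norm_sub_sq ℂ, ContinuousLinearMap.adjoint_inner_left, hPx,
        inner_self_eq_norm_sq]
      nlinarith [norm_nonneg (ContinuousLinearMap.adjoint P (P x))]
    have h3 : ‖ContinuousLinearMap.adjoint P (P x) - P x‖ = 0 := by
      nlinarith [norm_nonneg (ContinuousLinearMap.adjoint P (P x) - P x)]
    simpa [sub_eq_zero] using h3
  rw [← key]
  exact IsSelfAdjoint.star_mul_self P

end Projection

/-- A spectral family: a resolution of the identity consisting of orthogonal projections. -/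
structure IsSpectralFamily {H : Type*} [NormedAddCommGroup H] [InnerProductSpace ℂ H]
    [CompleteSpace H] (E : ℝ → H →L[ℂ] H) : Prop where
  resolution : IsResolutionOfIdentity E
  isSelfAdjoint : ∀ l, IsSelfAdjoint (E l)

/-! ### Spectral families and their scalar measures. -/

section Spectral

variable {H : Type*} [NormedAddCommGroup H] [InnerProductSpace ℂ H]

/-- The product rule covers only `l < m`; the diagonal case is its limit as `m ↓ l`. -/
lemma IsResolutionOfIdentity.isIdempotentElem {X : ℝ → H →L[ℂ] H} (hX : IsResolutionOfIdentity X)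
    (l : ℝ) : IsIdempotentElem (X l) := by
  ext ξ
  have h1 : Tendsto (fun m => X l (X m ξ)) (𝓝[>] l) (𝓝 (X l (X l ξ))) :=
    ((X l).continuous.tendsto _).comp (hX.right_continuous l ξ)
  have h2 : Tendsto (fun m => X l (X m ξ)) (𝓝[>] l) (𝓝 (X l ξ)) := by
    refine tendsto_const_nhds.congr' ?_
    filter_upwards [self_mem_nhdsWithin] with m hm
    exact (congrArg (fun T : H →L[ℂ] H => T ξ) (hX.mul_eq_left l m hm)).symm
  exact tendsto_nhds_unique h1 h2

variable [CompleteSpace H]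

lemma IsResolutionOfIdentity.isSpectralFamily {X : ℝ → H →L[ℂ] H}
    (hX : IsResolutionOfIdentity X) (hγ : resolutionBound X = 1) : IsSpectralFamily X where
  resolution := hX
  isSelfAdjoint l := (hX.isIdempotentElem l).isSelfAdjoint_of_norm_le_one
    ((le_ciSup hX.bounded l).trans_eq hγ)

namespace IsSpectralFamily

variable {E : ℝ → H →L[ℂ] H} (hE : IsSpectralFamily E)
include hE

lemma resolutionAbs_eq (l : ℝ) : resolutionAbs E l = E l := by
  have h1 := (hE.isSelfAdjoint l).adjoint_eq
  have h2 : IsStarProjection (E l) := ⟨hE.resolution.isIdempotentElem l, hE.isSelfAdjoint l⟩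
  rw [resolutionAbs, h1]
  exact CFC.sqrt_mul_self (E l) h2.nonneg

lemma apply_apply (l m : ℝ) (ξ : H) : E l (E m ξ) = E (min l m) ξ := by
  have key : E l * E m = E (min l m) := by
    rcases lt_trichotomy l m with h | rfl | h
    · rw [min_eq_left h.le, hE.resolution.mul_eq_left l m h]
    · rw [min_self]
      exact hE.resolution.isIdempotentElem l
    · rw [min_eq_right h.le, hE.resolution.mul_eq_right m l h]
  exact congrArg (fun T : H →L[ℂ] H => T ξ) key

lemma inner_apply_left (l : ℝ) (ξ η : H) : (inner ℂ (E l ξ) η : ℂ) = inner ℂ ξ (E l η) := by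
  rw [← ContinuousLinearMap.adjoint_inner_right, (hE.isSelfAdjoint l).adjoint_eq]

lemma inner_apply_self (l : ℝ) (ξ : H) : (inner ℂ ξ (E l ξ) : ℂ) = (‖E l ξ‖ ^ 2 : ℝ) := by
  conv_lhs => rw [← min_self l, ← hE.apply_apply, ← hE.inner_apply_left, inner_self_eq_norm_sq_to_K]
  norm_cast

lemma inner_apply_apply (l m : ℝ) (ξ : H) :
    (inner ℂ (E l ξ) (E m ξ) : ℂ) = (‖E (min l m) ξ‖ ^ 2 : ℝ) := by
  rw [hE.inner_apply_left, hE.apply_apply, hE.inner_apply_self]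

lemma norm_apply_le (l : ℝ) (ξ : H) : ‖E l ξ‖ ≤ ‖ξ‖ := by
  have h2 : IsStarProjection (E l) := ⟨hE.resolution.isIdempotentElem l, hE.isSelfAdjoint l⟩
  exact ((E l).le_of_opNorm_le (h2.norm_le (E l)) ξ).trans_eq (one_mul _)

lemma monotone_norm_sq (ξ : H) : Monotone fun l => ‖E l ξ‖ ^ 2 := by
  intro l m h
  have : E l ξ = E l (E m ξ) := by rw [hE.apply_apply, min_eq_left h]
  dsimp only
  rw [this]
  gcongr
  exact hE.norm_apply_le _ _

/-- The Lebesgue-Stieltjes measure of `l ↦ ‖E l ξ‖ ^ 2`. -/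
noncomputable def measure (ξ : H) : Measure ℝ := (hE.monotone_norm_sq ξ).stieltjesFunction.measure

lemma stieltjesFunction_apply (ξ : H) (l : ℝ) :
    (hE.monotone_norm_sq ξ).stieltjesFunction l = ‖E l ξ‖ ^ 2 :=
  rightLim_eq_of_tendsto ((hE.resolution.right_continuous l ξ).norm.pow 2)

lemma measure_Iic (ξ : H) (l : ℝ) : hE.measure ξ (Set.Iic l) = ENNReal.ofReal (‖E l ξ‖ ^ 2) := by
  have : Tendsto (hE.monotone_norm_sq ξ).stieltjesFunction atBot (𝓝 0) := by
    rw [funext (hE.stieltjesFunction_apply ξ)]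
    simpa using ((hE.resolution.tendsto_atBot ξ).norm.pow 2)
  rw [measure, StieltjesFunction.measure_Iic _ this, hE.stieltjesFunction_apply, sub_zero]

instance isFiniteMeasure_measure (ξ : H) : IsFiniteMeasure (hE.measure ξ) := by
  refine StieltjesFunction.isFiniteMeasure_of_forall_abs_le _ (C := ‖ξ‖ ^ 2) fun l => ?_
  rw [hE.stieltjesFunction_apply, abs_of_nonneg (by positivity)]
  gcongr
  exact hE.norm_apply_le _ _

lemma measure_real_Iic (ξ : H) (l : ℝ) : (hE.measure ξ).real (Set.Iic l) = ‖E l ξ‖ ^ 2 := by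
  rw [measureReal_def, hE.measure_Iic, ENNReal.toReal_ofReal (by positivity)]

/-- The parallelogram law on each half-line gives an equality with `hE.measure (ξ - η)` added on the
left. This makes the domain stable under addition. -/
lemma measure_add_le (ξ η : H) :
    hE.measure (ξ + η) ≤ (2 : ℝ≥0∞) • (hE.measure ξ + hE.measure η) := by
  have key : hE.measure (ξ + η) + hE.measure (ξ - η)
      = (2 : ℝ≥0∞) • (hE.measure ξ + hE.measure η) := by
    refine Measure.ext_of_Iic _ _ fun l => ?_
    simp only [Measure.add_apply, Measure.smul_apply, hE.measure_Iic, smul_eq_mul]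
    rw [← ENNReal.ofReal_add (by positivity) (by positivity),
      ← ENNReal.ofReal_add (by positivity) (by positivity), ← ENNReal.ofReal_ofNat 2,
      ← ENNReal.ofReal_mul (by positivity)]
    congr 1
    have := parallelogram_law_with_norm ℂ (E l ξ) (E l η)
    simp only [map_add, map_sub]
    linarith
  rw [← key]
  exact Measure.le_add_right le_rfl

lemma measure_smul (c : ℂ) (ξ : H) :
    hE.measure (c • ξ) = ENNReal.ofReal (‖c‖ ^ 2) • hE.measure ξ := by
  refine Measure.ext_of_Iic _ _ fun l => ?_
  rw [Measure.smul_apply, hE.measure_Iic, hE.measure_Iic, smul_eq_mul,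
    ← ENNReal.ofReal_mul (by positivity), map_smul, norm_smul, mul_pow]

lemma measure_sub_apply {a b : ℝ} (hab : a ≤ b) (ξ : H) :
    hE.measure (E b ξ - E a ξ) = (hE.measure ξ).restrict (Set.Ioc a b) := by
  refine Measure.ext_of_Iic _ _ fun l => ?_
  have h1 : Set.Iic l ∩ Set.Ioc a b = Set.Iic (min l b) \ Set.Iic (min l a) := by grind
  have h2 : (inner ℂ (E (min l b) ξ) (E (min l a) ξ) : ℂ) = (‖E (min l a) ξ‖ ^ 2 : ℝ) := by
    rw [hE.inner_apply_apply]
    congr 4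
    grind
  rw [Measure.restrict_apply measurableSet_Iic, h1, measure_sdiff (by grind)
    measurableSet_Iic.nullMeasurableSet (measure_ne_top _ _), hE.measure_Iic, hE.measure_Iic,
    hE.measure_Iic, ← ENNReal.ofReal_sub _ (by positivity), map_sub, hE.apply_apply,
    hE.apply_apply, @norm_sub_sq ℂ, h2]
  congr 1
  simp only [RCLike.re_to_complex, Complex.ofReal_re]
  ring

end IsSpectralFamily

end Spectral

/-! ### Density of step functions in L². -/

section Step

/-- Two families with the same Gram matrix have linear combinations of the same norm. -/
lemma Finsupp.norm_linearCombination_eq_of_inner_eq {𝕜 V W ι : Type*} [RCLike 𝕜]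
    [NormedAddCommGroup V] [InnerProductSpace 𝕜 V] [NormedAddCommGroup W] [InnerProductSpace 𝕜 W]
    {v : ι → V} {w : ι → W} (h : ∀ i j, (inner 𝕜 (v i) (v j) : 𝕜) = inner 𝕜 (w i) (w j))
    (c : ι →₀ 𝕜) :
    ‖Finsupp.linearCombination 𝕜 v c‖ = ‖Finsupp.linearCombination 𝕜 w c‖ := by
  have key : (inner 𝕜 (Finsupp.linearCombination 𝕜 v c) (Finsupp.linearCombination 𝕜 v c) : 𝕜)
      = inner 𝕜 (Finsupp.linearCombination 𝕜 w c) (Finsupp.linearCombination 𝕜 w c) := by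
    simp only [Finsupp.linearCombination_apply, Finsupp.sum, sum_inner, inner_sum, inner_smul_left,
      inner_smul_right, h]
  rw [@norm_eq_sqrt_re_inner 𝕜, @norm_eq_sqrt_re_inner 𝕜, key]

variable (𝕜 : Type*) [RCLike 𝕜] (μ : Measure ℝ)

variable {𝕜 μ} in
lemma ae_eq_zero_of_forall_setIntegral_Iic {f : ℝ → 𝕜} (hf : Integrable f μ)
    (h : ∀ t, ∫ x in Set.Iic t, f x ∂μ = 0) : f =ᵐ[μ] 0 := by
  rw [← hf.withDensityᵥ_eq_iff (integrable_zero _ _ _)]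
  have h1 : ∀ t, μ.withDensityᵥ f (Set.Iic t) = 0 := fun t => by
    rw [withDensityᵥ_apply hf measurableSet_Iic, h]
  rw [withDensityᵥ_zero]
  refine VectorMeasure.ext_of_generateFrom (Set.range Set.Iic) ?_
    ((BorelSpace.measurable_eq (α := ℝ)).trans (borel_eq_generateFrom_Iic ℝ)) isPiSystem_Iic ?_
  · rintro _ ⟨t, rfl⟩
    simpa using h1 t
  -- The half-lines form a π-system without the whole line, so the total mass is recovered as a
  -- limit.
  · have h2 : Set.univ = ⋃ n : ℕ, Set.Iic (n : ℝ) := by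
      refine (Set.iUnion_eq_univ_iff.2 fun x => ?_).symm
      exact exists_nat_ge x
    have h3 : Tendsto (fun n : ℕ => μ.withDensityᵥ f (Set.Iic (n : ℝ))) atTop
        (𝓝 (μ.withDensityᵥ f Set.univ)) := by
      rw [h2]
      exact VectorMeasure.tendsto_vectorMeasure_iUnion_atTop_nat
        (fun m n hmn => Set.Iic_subset_Iic.2 (Nat.cast_le.2 hmn)) (fun n => measurableSet_Iic)
    simp only [h1] at h3
    simpa using tendsto_nhds_unique h3 tendsto_const_nhds

variable [IsFiniteMeasure μ]

/-- The step function `∑ t, c t • 1_{(-∞, t]}`. -/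
noncomputable def stepFun : (ℝ →₀ 𝕜) →ₗ[𝕜] (ℝ → 𝕜) :=
  Finsupp.linearCombination 𝕜 fun t => (Set.Iic t).indicator fun _ => (1 : 𝕜)

/-- The class in `L²(μ)` of the step function `∑ t, c t • 1_{(-∞, t]}`. -/
noncomputable def stepLp : (ℝ →₀ 𝕜) →ₗ[𝕜] Lp 𝕜 2 μ :=
  Finsupp.linearCombination 𝕜 fun t =>
    indicatorConstLp 2 (measurableSet_Iic (a := t)) (measure_ne_top μ _) (1 : 𝕜)

lemma stepLp_coeFn (c : ℝ →₀ 𝕜) : stepLp 𝕜 μ c =ᵐ[μ] stepFun 𝕜 c := by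
  induction c using Finsupp.induction_linear with
  | zero =>
    simp only [map_zero]
    exact Lp.coeFn_zero _ _ _
  | add f g hf hg =>
    simp only [map_add]
    exact (Lp.coeFn_add _ _).trans (hf.add hg)
  | single t a =>
    simp only [stepLp, stepFun, Finsupp.linearCombination_single]
    exact (Lp.coeFn_smul _ _).trans (indicatorConstLp_coeFn.const_smul a)

/-- A function orthogonal to all step functions has zero integral over every half-line, hence
vanishes almost everywhere. -/
lemma denseRange_stepLp : DenseRange (stepLp 𝕜 μ) := by
  have h : (LinearMap.range (stepLp 𝕜 μ)).topologicalClosure = ⊤ := by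
    rw [Submodule.topologicalClosure_eq_top_iff, eq_bot_iff]
    intro g hg
    rw [Submodule.mem_orthogonal] at hg
    have h1 : ∀ t, ∫ x in Set.Iic t, g x ∂μ = 0 := fun t => by
      rw [← L2.inner_indicatorConstLp_one measurableSet_Iic (measure_ne_top μ _)]
      refine hg _ ⟨Finsupp.single t 1, ?_⟩
      simp [stepLp]
    have h2 := ae_eq_zero_of_forall_setIntegral_Iic ((Lp.memLp g).integrable one_le_two) h1
    exact (Lp.eq_zero_iff_ae_eq_zero).2 h2
  have h2 := Submodule.dense_iff_topologicalClosure_eq_top.2 h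
  rwa [LinearMap.coe_range] at h2

lemma norm_stepLp_sub_toLp {f : ℝ → 𝕜} (hf : MemLp f 2 μ) (c : ℝ →₀ 𝕜) :
    ‖stepLp 𝕜 μ c - hf.toLp f‖ = (eLpNorm (stepFun 𝕜 c - f) 2 μ).toReal := by
  rw [Lp.norm_def]
  congr 1
  exact eLpNorm_congr_ae ((Lp.coeFn_sub _ _).trans ((stepLp_coeFn 𝕜 μ c).sub hf.coeFn_toLp))

variable {𝕜 μ}

lemma MeasureTheory.MemLp.exists_stepFun_tendsto {f : ℝ → 𝕜} (hf : MemLp f 2 μ) :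
    ∃ c : ℕ → ℝ →₀ 𝕜, Tendsto (fun n => eLpNorm (stepFun 𝕜 (c n) - f) 2 μ) atTop (𝓝 0) := by
  obtain ⟨u, hu, hlim⟩ := mem_closure_iff_seq_limit.1 (denseRange_stepLp 𝕜 μ (hf.toLp f))
  choose c hc using hu
  refine ⟨c, ?_⟩
  have h := tendsto_iff_norm_sub_tendsto_zero.1 hlim
  simp only [← hc, norm_stepLp_sub_toLp] at h
  refine (ENNReal.tendsto_toReal_iff (fun n => ?_) ENNReal.zero_ne_top).1 (by simpa using h)
  have h2 := Lp.memLp (stepLp 𝕜 μ (c n))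
  exact ((memLp_congr_ae (stepLp_coeFn 𝕜 μ (c n))).1 h2 |>.sub hf).eLpNorm_ne_top

end Step

/-! ### Integration against a complex measure with a density. -/

section ComplexDensity

variable {μ : Measure ℝ} {h : ℝ → ℂ}

lemma integrable_variation_withDensityᵥ_iff (hh : Integrable h μ) {f : ℝ → ℝ} :
    Integrable f (μ.withDensityᵥ h).variation ↔ Integrable (fun x => ‖h x‖ * f x) μ := by
  rw [Measure.variation_withDensityᵥ hh, integrable_withDensity_iff_integrable_smul₀'
    hh.aestronglyMeasurable.enorm (by simp)]
  simp

lemma integrable_ofReal_mul_of_variation_withDensityᵥ (hh : Integrable h μ) {f : ℝ → ℝ}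
    (hf : AEStronglyMeasurable f μ)
    (hfi : Integrable f (μ.withDensityᵥ h).variation) :
    Integrable (fun x => (f x : ℂ) * h x) μ := by
  refine ((integrable_variation_withDensityᵥ_iff hh).1 hfi).mono
    ((Complex.continuous_ofReal.comp_aestronglyMeasurable hf).mul hh.aestronglyMeasurable) ?_
  filter_upwards with x
  simp [mul_comm]

lemma isFiniteMeasure_variation_withDensityᵥ (hh : Integrable h μ) :
    IsFiniteMeasure (μ.withDensityᵥ h).variation := by
  rw [Measure.variation_withDensityᵥ hh]
  exact ⟨by simpa using! hh.2⟩

lemma integral_withDensityᵥ_simpleFunc (hh : Integrable h μ) (g : SimpleFunc ℝ ℝ) :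
    (∫ᵛ x, g x ∂•(μ.withDensityᵥ h)) = ∫ x, (g x : ℂ) * h x ∂μ := by
  have := isFiniteMeasure_variation_withDensityᵥ hh
  have hint : ∀ g : SimpleFunc ℝ ℝ, Integrable g (μ.withDensityᵥ h).variation :=
    fun g => g.integrable_of_isFiniteMeasure
  induction g using SimpleFunc.induction with
  | @const c s hs =>
    have h1 : ∀ x, ((s.indicator (fun _ => c) x : ℝ) : ℂ) * h x
        = s.indicator (fun x => (c : ℂ) * h x) x := fun x => by
      by_cases hx : x ∈ s <;> simp [hx]
    have hp : ⇑(SimpleFunc.piecewise s hs (SimpleFunc.const ℝ c) (SimpleFunc.const ℝ 0))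
        = s.indicator fun _ => c := by
      ext x
      by_cases hx : x ∈ s <;> simp [hx]
    rw [hp]
    rw [VectorMeasure.integral_indicator hs, VectorMeasure.setIntegral_const,
      integral_congr_ae (Eventually.of_forall h1), MeasureTheory.integral_indicator hs,
      integral_const_mul, withDensityᵥ_apply hh hs]
    simp
  | @add g₁ g₂ hd h₁ h₂ =>
    have hi := fun g => integrable_ofReal_mul_of_variation_withDensityᵥ hh
      (SimpleFunc.aestronglyMeasurable g) (hint g)
    simp only [SimpleFunc.coe_add, Pi.add_apply, Complex.ofReal_add, add_mul]
    rw [VectorMeasure.integral_fun_add (hint g₁) (hint g₂), h₁, h₂, integral_add (hi g₁) (hi g₂)]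

/-- The integral of a function against the complex measure of density `h` with respect to `μ`. -/
lemma integral_withDensityᵥ_complex (hh : Integrable h μ) {f : ℝ → ℝ} (hfm : Measurable f)
    (hf : Integrable f (μ.withDensityᵥ h).variation) :
    (∫ᵛ x, f x ∂•(μ.withDensityᵥ h)) = ∫ x, (f x : ℂ) * h x ∂μ := by
  let φ : ℕ → SimpleFunc ℝ ℝ := SimpleFunc.approxOn f hfm Set.univ 0 (Set.mem_univ 0)
  have hφ : ∀ x, Tendsto (fun n => φ n x) atTop (𝓝 (f x)) := fun x =>
    SimpleFunc.tendsto_approxOn hfm (Set.mem_univ 0) (by simp)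
  have hb : ∀ n x, ‖φ n x‖ ≤ ‖f x‖ + ‖f x‖ := fun n x =>
    SimpleFunc.norm_approxOn_zero_le hfm (Set.mem_univ 0) x n
  have h1 : Tendsto (fun n => ∫ᵛ x, φ n x ∂•(μ.withDensityᵥ h)) atTop
      (𝓝 (∫ᵛ x, f x ∂•(μ.withDensityᵥ h))) :=
    VectorMeasure.tendsto_integral_of_dominated_convergence (fun x => ‖f x‖ + ‖f x‖)
      (fun n => (φ n).aestronglyMeasurable) (hf.norm.add hf.norm)
      (fun n => Eventually.of_forall (hb n)) (Eventually.of_forall hφ)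
  have h2 : Tendsto (fun n => ∫ x, (φ n x : ℂ) * h x ∂μ) atTop
      (𝓝 (∫ x, (f x : ℂ) * h x ∂μ)) := by
    have hi := ((integrable_variation_withDensityᵥ_iff hh).1 hf).norm
    refine MeasureTheory.tendsto_integral_of_dominated_convergence _ (fun n => ?_) (hi.add hi)
      (fun n => Eventually.of_forall fun x => ?_) (Eventually.of_forall fun x => ?_)
    · exact (Complex.continuous_ofReal.comp_aestronglyMeasurable
        (φ n).aestronglyMeasurable).mul hh.aestronglyMeasurable
    · simp only [norm_mul, Complex.norm_real, norm_norm, Pi.add_apply]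
      nlinarith [hb n x, norm_nonneg (h x)]
    · exact ((Complex.continuous_ofReal.tendsto _).comp (hφ x)).mul_const _
  simp only [integral_withDensityᵥ_simpleFunc hh] at h1
  exact tendsto_nhds_unique h1 h2

end ComplexDensity

/-! ### The isometry from L² into `H`, and the density of the sesquilinear measures. -/

lemma boundedVariationOn_of_edist_le_measure_Ioc {E : Type*} [PseudoEMetricSpace E] {f : ℝ → E}
    (m : Measure ℝ) [IsFiniteMeasure m]
    (h : ∀ a b, a ≤ b → edist (f b) (f a) ≤ m (Set.Ioc a b)) : BoundedVariationOn f Set.univ := by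
  refine ne_top_of_le_ne_top (measure_ne_top m Set.univ) (iSup_le fun p => ?_)
  obtain ⟨n, u, hu, -⟩ := p
  refine (Finset.sum_le_sum fun i _ => h _ _ (hu i.le_succ)).trans ?_
  refine sum_measure_le_measure_univ (fun i _ => measurableSet_Ioc.nullMeasurableSet) ?_
  exact fun i _ j _ hij => (hu.pairwise_disjoint_on_Ioc_succ hij).aedisjoint

namespace IsSpectralFamily

variable {H : Type*} [NormedAddCommGroup H] [InnerProductSpace ℂ H] [CompleteSpace H]
  {E : ℝ → H →L[ℂ] H} (hE : IsSpectralFamily E)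
include hE

/-- Both Gram matrices have entries `‖E (min s t) ξ‖²`. This is what lets `lpMap` extend to an
isometry. -/
lemma norm_stepLp (ξ : H) (c : ℝ →₀ ℂ) :
    ‖stepLp ℂ (hE.measure ξ) c‖ = ‖Finsupp.linearCombination ℂ (fun t => E t ξ) c‖ := by
  refine Finsupp.norm_linearCombination_eq_of_inner_eq (fun s t => ?_) c
  rw [L2.inner_indicatorConstLp_indicatorConstLp, hE.inner_apply_apply, Set.Iic_inter_Iic,
    hE.measure_real_Iic]
  simp

/-- The map `f ↦ (∫ f dE) ξ` on `L²`, sending the indicator function of `(-∞, t]` to `E t ξ`. -/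
noncomputable def lpMap (ξ : H) : Lp ℂ 2 (hE.measure ξ) →L[ℂ] H :=
  (Finsupp.linearCombination ℂ fun t => E t ξ).extendOfNorm (stepLp ℂ (hE.measure ξ))

lemma lpMap_stepLp (ξ : H) (c : ℝ →₀ ℂ) :
    hE.lpMap ξ (stepLp ℂ (hE.measure ξ) c) = Finsupp.linearCombination ℂ (fun t => E t ξ) c := by
  have hn : ∃ C : ℝ, ∀ c, ‖Finsupp.linearCombination ℂ (fun t => E t ξ) c‖
      ≤ C * ‖stepLp ℂ (hE.measure ξ) c‖ := ⟨1, fun c => by rw [one_mul, hE.norm_stepLp]⟩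
  exact LinearMap.extendOfNorm_eq (denseRange_stepLp ℂ (hE.measure ξ)) hn c

lemma norm_lpMap (ξ : H) (f : Lp ℂ 2 (hE.measure ξ)) : ‖hE.lpMap ξ f‖ = ‖f‖ := by
  refine (denseRange_stepLp ℂ (hE.measure ξ)).induction_on f
    (isClosed_eq (by fun_prop) (by fun_prop)) fun c => ?_
  rw [hE.lpMap_stepLp, hE.norm_stepLp]

/-- The density of `l ↦ ⟨E l ξ, η⟩` with respect to the measure of `ξ`. -/
noncomputable def density (ξ η : H) (l : ℝ) : ℂ :=
  starRingEnd ℂ (ContinuousLinearMap.adjoint (hE.lpMap ξ) η l)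

lemma memLp_density (ξ η : H) : MemLp (hE.density ξ η) 2 (hE.measure ξ) :=
  (Lp.memLp _).star

lemma integrable_density (ξ η : H) : Integrable (hE.density ξ η) (hE.measure ξ) :=
  (hE.memLp_density ξ η).integrable one_le_two

lemma inner_lpMap (ξ η : H) (f : Lp ℂ 2 (hE.measure ξ)) :
    (inner ℂ η (hE.lpMap ξ f) : ℂ) = ∫ l, f l * hE.density ξ η l ∂(hE.measure ξ) := by
  rw [← ContinuousLinearMap.adjoint_inner_left, L2.inner_def]
  simp only [RCLike.inner_apply, density]

lemma inner_apply (ξ η : H) (l : ℝ) :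
    (inner ℂ η (E l ξ) : ℂ) = ∫ x in Set.Iic l, hE.density ξ η x ∂(hE.measure ξ) := by
  have h1 : hE.lpMap ξ (indicatorConstLp 2 (measurableSet_Iic (a := l))
      (measure_ne_top (hE.measure ξ) _) (1 : ℂ)) = E l ξ := by
    have := hE.lpMap_stepLp ξ (Finsupp.single l 1)
    simpa [stepLp] using this
  rw [← h1, hE.inner_lpMap, ← integral_indicator measurableSet_Iic]
  refine integral_congr_ae ?_
  filter_upwards [indicatorConstLp_coeFn (p := 2) (hs := measurableSet_Iic (a := l))
    (hμs := measure_ne_top (hE.measure ξ) _) (c := (1 : ℂ))] with x hx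
  rw [hx]
  by_cases h : x ∈ Set.Iic l <;> simp [h]

lemma inner_sub (ξ η : H) {a b : ℝ} (hab : a ≤ b) :
    (inner ℂ η (E b ξ) : ℂ) - inner ℂ η (E a ξ)
      = ∫ x in Set.Ioc a b, hE.density ξ η x ∂(hE.measure ξ) := by
  rw [hE.inner_apply, hE.inner_apply, ← Set.Iic_union_Ioc_eq_Iic hab,
    setIntegral_union (by grind) measurableSet_Ioc
    (hE.integrable_density ξ η).integrableOn (hE.integrable_density ξ η).integrableOn,
    add_sub_cancel_left]

lemma boundedVariationOn (ξ η : H) :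
    BoundedVariationOn (fun l => (inner ℂ η (E l ξ) : ℂ)) Set.univ := by
  have hi := hE.integrable_density ξ η
  have := isFiniteMeasure_variation_withDensityᵥ hi
  rw [Measure.variation_withDensityᵥ hi] at this
  refine boundedVariationOn_of_edist_le_measure_Ioc
    ((hE.measure ξ).withDensity fun l => ‖hE.density ξ η l‖ₑ) fun a b hab => ?_
  rw [edist_eq_enorm_sub, hE.inner_sub ξ η hab, withDensity_apply _ measurableSet_Ioc]
  exact enorm_integral_le_lintegral_enorm _

/-- Both measures take the value `⟨E l ξ, η⟩` on `(-∞, l]`: right continuity removes the right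
limit, and the limit at `-∞` is zero. -/
lemma vectorMeasure_eq (ξ η : H) :
    (hE.boundedVariationOn ξ η).vectorMeasure = (hE.measure ξ).withDensityᵥ (hE.density ξ η) := by
  have hi := hE.integrable_density ξ η
  have hlim : ∀ l, Function.rightLim (fun l => (inner ℂ η (E l ξ) : ℂ)) l = inner ℂ η (E l ξ) :=
    fun l => rightLim_eq_of_tendsto
      (((innerSL ℂ η).continuous.tendsto _).comp (hE.resolution.right_continuous l ξ))
  have hbot : limUnder atBot (fun l => (inner ℂ η (E l ξ) : ℂ)) = 0 := by
    refine Tendsto.limUnder_eq ?_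
    simpa using! ((innerSL ℂ η).continuous.tendsto _).comp (hE.resolution.tendsto_atBot ξ)
  have hIic : ∀ l, (hE.boundedVariationOn ξ η).vectorMeasure (Set.Iic l)
      = (hE.measure ξ).withDensityᵥ (hE.density ξ η) (Set.Iic l) := fun l => by
    rw [BoundedVariationOn.vectorMeasure_Iic, hlim, hbot, sub_zero,
      withDensityᵥ_apply hi measurableSet_Iic, hE.inner_apply]
  refine VectorMeasure.ext_of_generateFrom (Set.range Set.Iic) ?_
    ((BorelSpace.measurable_eq (α := ℝ)).trans (borel_eq_generateFrom_Iic ℝ)) isPiSystem_Iic ?_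
  · rintro _ ⟨t, rfl⟩
    exact hIic t
  · have h2 : Set.univ = ⋃ n : ℕ, Set.Iic (n : ℝ) :=
      (Set.iUnion_eq_univ_iff.2 fun x => exists_nat_ge x).symm
    have h3 : ∀ v : VectorMeasure ℝ ℂ,
        Tendsto (fun n : ℕ => v (Set.Iic (n : ℝ))) atTop (𝓝 (v Set.univ)) := fun v => by
      rw [h2]
      exact VectorMeasure.tendsto_vectorMeasure_iUnion_atTop_nat
        (fun m n hmn => Set.Iic_subset_Iic.2 (Nat.cast_le.2 hmn)) (fun n => measurableSet_Iic)
    refine tendsto_nhds_unique (h3 _) ?_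
    simp only [hIic]
    exact h3 _

/-! ### The operator at a single vector. -/

/-- `ξ` lies in the domain of `∫ l dE`. -/
abbrev MemDomain (ξ : H) : Prop := MemLp (fun l : ℝ => (l : ℂ)) 2 (hE.measure ξ)

/-- The vector `(∫ l dE) ξ`, with value `0` outside of the domain. -/
noncomputable def opFun (ξ : H) : H :=
  open Classical in if h : hE.MemDomain ξ then hE.lpMap ξ (MemLp.toLp _ h) else 0

variable {hE}

lemma MemDomain.opFun_eq {ξ : H} (h : hE.MemDomain ξ) : hE.opFun ξ = hE.lpMap ξ (MemLp.toLp _ h) :=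
  dif_pos h

lemma MemDomain.memLp_id {ξ : H} (h : hE.MemDomain ξ) : MemLp (fun l : ℝ => l) 2 (hE.measure ξ) :=
  h.re

/-- The total variation has density `‖hE.density ξ η‖`, which is in L², as is `l`; their product is
integrable by Cauchy–Schwarz. -/
lemma MemDomain.integrable {ξ : H} (h : hE.MemDomain ξ) (η : H) :
    Integrable (fun l : ℝ => l) (hE.boundedVariationOn ξ η).vectorMeasure.variation := by
  rw [hE.vectorMeasure_eq, integrable_variation_withDensityᵥ_iff (hE.integrable_density ξ η)]
  exact (hE.memLp_density ξ η).norm.integrable_mul h.memLp_id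

lemma MemDomain.inner_opFun {ξ : H} (h : hE.MemDomain ξ) (η : H) :
    (inner ℂ η (hE.opFun ξ) : ℂ) = ∫ᵛ l : ℝ, l ∂•(hE.boundedVariationOn ξ η).vectorMeasure := by
  have h1 := h.integrable η
  rw [hE.vectorMeasure_eq] at h1 ⊢
  rw [integral_withDensityᵥ_complex (hE.integrable_density ξ η) measurable_id' h1, h.opFun_eq,
    hE.inner_lpMap]
  refine integral_congr_ae ?_
  filter_upwards [MemLp.coeFn_toLp h] with l hl
  rw [hl]

lemma memDomain_iff {ξ : H} :
    hE.MemDomain ξ ↔ ∫⁻ l : ℝ, ENNReal.ofReal (l ^ 2) ∂(hE.measure ξ) < ∞ := by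
  have hm : AEStronglyMeasurable (fun l : ℝ => (l : ℂ)) (hE.measure ξ) :=
    Complex.continuous_ofReal.aestronglyMeasurable
  rw [MemDomain, MemLp, and_iff_right hm, eLpNorm_lt_top_iff_lintegral_rpow_enorm_lt_top
    two_ne_zero ENNReal.ofNat_ne_top]
  have : ∀ l : ℝ, ‖(l : ℂ)‖ₑ ^ (2 : ℝ≥0∞).toReal = ENNReal.ofReal (l ^ 2) := fun l => by
    rw [← ofReal_norm, Complex.norm_real, ENNReal.toReal_ofNat, ENNReal.rpow_ofNat,
      ← ENNReal.ofReal_pow (norm_nonneg _), Real.norm_eq_abs, sq_abs]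
  simp only [this]

lemma MemDomain.norm_opFun_sq {ξ : H} (h : hE.MemDomain ξ) :
    ENNReal.ofReal (‖hE.opFun ξ‖ ^ 2) = ∫⁻ l : ℝ, ENNReal.ofReal (l ^ 2) ∂(hE.measure ξ) := by
  rw [h.opFun_eq, hE.norm_lpMap, Lp.norm_toLp, ENNReal.ofReal_pow ENNReal.toReal_nonneg,
    ENNReal.ofReal_toReal h.eLpNorm_ne_top]
  have : ∀ l : ℝ, ‖(l : ℂ)‖ₑ ^ 2 = ENNReal.ofReal (l ^ 2) := fun l => by
    rw [← ofReal_norm, Complex.norm_real,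
      ← ENNReal.ofReal_pow (norm_nonneg _), Real.norm_eq_abs, sq_abs]
  simp only [← this]
  simpa using eLpNorm_nnreal_pow_eq_lintegral (f := fun l : ℝ => (l : ℂ)) (μ := hE.measure ξ)
    (p := 2) two_ne_zero

end IsSpectralFamily

/-! ### Linearity and symmetry through step operators. -/

namespace IsSpectralFamily

variable {H : Type*} [NormedAddCommGroup H] [InnerProductSpace ℂ H] [CompleteSpace H]
  {E : ℝ → H →L[ℂ] H} (hE : IsSpectralFamily E)
include hE

/-- The operator `∑ t, c t • E t`. -/
noncomputable def stepOp (_ : IsSpectralFamily E) (c : ℝ →₀ ℝ) : H →L[ℂ] H :=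
  c.sum fun t a => (a : ℂ) • E t

lemma stepOp_apply (c : ℝ →₀ ℝ) (ξ : H) :
    hE.stepOp c ξ = c.sum fun t a => (a : ℂ) • E t ξ := by
  simp [stepOp, Finsupp.sum]

lemma inner_stepOp_left (c : ℝ →₀ ℝ) (ξ η : H) :
    (inner ℂ (hE.stepOp c ξ) η : ℂ) = inner ℂ ξ (hE.stepOp c η) := by
  simp only [stepOp_apply, Finsupp.sum, sum_inner, inner_sum, inner_smul_left, inner_smul_right,
    hE.inner_apply_left, Complex.conj_ofReal]

lemma apply_stepOp (c : ℝ →₀ ℝ) (l : ℝ) (ξ : H) :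
    E l (hE.stepOp c ξ) = hE.stepOp c (E l ξ) := by
  simp only [stepOp_apply, Finsupp.sum, map_sum, map_smul, hE.apply_apply, min_comm]

/-- Both vectors are images under the isometry `lpMap ξ`, of the step function and of `l`. Real
coefficients are kept because they make the step operators symmetric. -/
lemma norm_stepOp_sub_opFun {ξ : H} (h : hE.MemDomain ξ) (c : ℝ →₀ ℝ) :
    ‖hE.stepOp c ξ - hE.opFun ξ‖
      = (eLpNorm (stepFun ℝ c - fun l => l) 2 (hE.measure ξ)).toReal := by
  have h1 : hE.stepOp c ξ = hE.lpMap ξ (stepLp ℂ (hE.measure ξ)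
      (c.mapRange (fun a : ℝ => (a : ℂ)) Complex.ofReal_zero)) := by
    rw [hE.lpMap_stepLp, Finsupp.linearCombination_apply,
      Finsupp.sum_mapRange_index (h := fun t (a : ℂ) => a • E t ξ) (by simp), stepOp_apply]
  have h2 : ∀ x, stepFun ℂ (c.mapRange (fun a : ℝ => (a : ℂ)) Complex.ofReal_zero) x
      = (stepFun ℝ c x : ℂ) := fun x => by
    rw [stepFun, Finsupp.linearCombination_apply, Finsupp.sum_mapRange_index
      (h := fun t (a : ℂ) => a • (Set.Iic t).indicator fun _ => (1 : ℂ)) (by simp), stepFun,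
      Finsupp.linearCombination_apply, Finsupp.sum, Finsupp.sum,
      Finset.sum_apply, Finset.sum_apply, Complex.ofReal_sum]
    refine Finset.sum_congr rfl fun t _ => ?_
    by_cases hx : x ∈ Set.Iic t <;> simp [Set.indicator, hx]
  rw [h1, h.opFun_eq, ← map_sub, hE.norm_lpMap, norm_stepLp_sub_toLp]
  congr 1
  refine eLpNorm_congr_norm_ae (Eventually.of_forall fun x => ?_)
  rw [Pi.sub_apply, Pi.sub_apply, h2, ← Complex.ofReal_sub, Complex.norm_real]

/-- On finitely many vectors of the domain, `∫ l dE` is a strong limit of operators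
`∑ t, c t • E t`. -/
lemma exists_stepOp_tendsto (s : Finset H) (hs : ∀ ξ ∈ s, hE.MemDomain ξ) :
    ∃ c : ℕ → ℝ →₀ ℝ, ∀ ξ ∈ s, Tendsto (fun n => hE.stepOp (c n) ξ) atTop (𝓝 (hE.opFun ξ)) := by
  -- The sum dominates each of the measures, so one approximating sequence in its L² serves all
  -- vectors of `s`.
  have hfin : IsFiniteMeasure (∑ ξ ∈ s, hE.measure ξ) := by
    refine ⟨?_⟩
    rw [Measure.finsetSum_apply]
    exact ENNReal.sum_lt_top.2 fun ξ _ => measure_lt_top _ _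
  have hmem : MemLp (fun l : ℝ => l) 2 (∑ ξ ∈ s, hE.measure ξ) := by
    rw [memLp_two_iff_integrable_sq measurable_id'.aestronglyMeasurable,
      integrable_finsetSum_measure]
    exact fun ξ hξ => (hs ξ hξ).memLp_id.integrable_sq
  obtain ⟨c, hc⟩ := hmem.exists_stepFun_tendsto
  refine ⟨c, fun ξ hξ => ?_⟩
  have hle : hE.measure ξ ≤ ∑ ξ ∈ s, hE.measure ξ := by
    refine Measure.le_iff'.2 fun A => ?_
    rw [Measure.finsetSum_apply]
    exact Finset.single_le_sum (f := fun ξ => hE.measure ξ A) (fun _ _ => zero_le) hξ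
  have h0 := tendsto_of_tendsto_of_tendsto_of_le_of_le tendsto_const_nhds hc (fun _ => zero_le)
    (fun n => eLpNorm_mono_measure (p := 2) (stepFun ℝ (c n) - fun l => l) hle)
  rw [tendsto_iff_norm_sub_tendsto_zero]
  simp only [hE.norm_stepOp_sub_opFun (hs ξ hξ)]
  simpa using! (ENNReal.tendsto_toReal ENNReal.zero_ne_top).comp h0

lemma memDomain_zero : hE.MemDomain (0 : H) := by
  have : hE.measure 0 = 0 := by simpa using hE.measure_smul 0 0
  simp [memDomain_iff, this]

variable {hE}

lemma MemDomain.add {ξ η : H} (hξ : hE.MemDomain ξ) (hη : hE.MemDomain η) :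
    hE.MemDomain (ξ + η) := by
  rw [memDomain_iff] at hξ hη ⊢
  refine (lintegral_mono' (hE.measure_add_le ξ η) le_rfl).trans_lt ?_
  rw [lintegral_smul_measure, lintegral_add_measure]
  exact ENNReal.mul_lt_top ENNReal.ofNat_lt_top (ENNReal.add_lt_top.2 ⟨hξ, hη⟩)

lemma MemDomain.smul {ξ : H} (hξ : hE.MemDomain ξ) (a : ℂ) : hE.MemDomain (a • ξ) := by
  rw [MemDomain, hE.measure_smul]
  exact hξ.smul_measure ENNReal.ofReal_ne_top

lemma opFun_add {ξ η : H} (hξ : hE.MemDomain ξ) (hη : hE.MemDomain η) :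
    hE.opFun (ξ + η) = hE.opFun ξ + hE.opFun η := by
  classical
  obtain ⟨c, hc⟩ := hE.exists_stepOp_tendsto {ξ, η, ξ + η} (by simp [hξ, hη, hξ.add hη])
  refine tendsto_nhds_unique (hc _ (by simp)) ?_
  simpa only [map_add] using (hc ξ (by simp)).add (hc η (by simp))

lemma opFun_smul {ξ : H} (hξ : hE.MemDomain ξ) (a : ℂ) :
    hE.opFun (a • ξ) = a • hE.opFun ξ := by
  classical
  obtain ⟨c, hc⟩ := hE.exists_stepOp_tendsto {ξ, a • ξ} (by simp [hξ, hξ.smul a])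
  refine tendsto_nhds_unique (hc _ (by simp)) ?_
  simpa only [map_smul] using (hc ξ (by simp)).const_smul a

lemma inner_opFun_left {ξ η : H} (hξ : hE.MemDomain ξ) (hη : hE.MemDomain η) :
    (inner ℂ (hE.opFun ξ) η : ℂ) = inner ℂ ξ (hE.opFun η) := by
  classical
  obtain ⟨c, hc⟩ := hE.exists_stepOp_tendsto {ξ, η} (by simp [hξ, hη])
  refine tendsto_nhds_unique ((hc ξ (by simp)).inner (tendsto_const_nhds (x := η))) ?_
  simp only [hE.inner_stepOp_left]
  exact tendsto_const_nhds.inner (hc η (by simp))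

variable (hE)

/-- The selfadjoint operator `∫ l dE`. -/
noncomputable def op : H →ₗ.[ℂ] H where
  domain :=
    { carrier := {ξ | hE.MemDomain ξ}
      add_mem' := MemDomain.add
      zero_mem' := hE.memDomain_zero
      smul_mem' := fun a _ h => MemDomain.smul h a }
  toFun :=
    { toFun := fun ξ => hE.opFun ξ
      map_add' := fun ξ η => opFun_add ξ.2 η.2
      map_smul' := fun a ξ => opFun_smul ξ.2 a }

lemma op_apply (ξ : hE.op.domain) : hE.op ξ = hE.opFun ξ := rfl

/-! ### Cutoffs, density of the domain and self-adjointness. -/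

/-- The spectral projection of the interval `(-n, n]`. -/
noncomputable def cutoff (_ : IsSpectralFamily E) (n : ℕ) : H →L[ℂ] H := E n - E (-n)

lemma cutoff_apply (n : ℕ) (ξ : H) : hE.cutoff n ξ = E n ξ - E (-n) ξ := rfl

lemma measure_cutoff (n : ℕ) (ξ : H) :
    hE.measure (hE.cutoff n ξ) = (hE.measure ξ).restrict (Set.Ioc (-n : ℝ) n) :=
  hE.measure_sub_apply (neg_le_self n.cast_nonneg) ξ

lemma memDomain_of_measure_le_restrict {ξ η : H} {n : ℕ}
    (h : hE.measure ξ ≤ (hE.measure η).restrict (Set.Ioc (-n : ℝ) n)) : hE.MemDomain ξ := by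
  refine MemLp.mono_measure h ?_
  refine MemLp.of_bound Complex.continuous_ofReal.aestronglyMeasurable n ?_
  filter_upwards [ae_restrict_mem measurableSet_Ioc] with l hl
  rw [Complex.norm_real, Real.norm_eq_abs, abs_le]
  exact ⟨hl.1.le, hl.2⟩

lemma memDomain_cutoff (n : ℕ) (ξ : H) : hE.MemDomain (hE.cutoff n ξ) :=
  hE.memDomain_of_measure_le_restrict (hE.measure_cutoff n ξ).le

lemma tendsto_cutoff (ξ : H) : Tendsto (fun n => hE.cutoff n ξ) atTop (𝓝 ξ) := by
  have h1 := (hE.resolution.tendsto_atTop ξ).comp (tendsto_natCast_atTop_atTop (R := ℝ))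
  have h2 := (hE.resolution.tendsto_atBot ξ).comp
    (tendsto_neg_atTop_atBot.comp (tendsto_natCast_atTop_atTop (R := ℝ)))
  simpa using! h1.sub h2

lemma cutoff_cutoff (n : ℕ) (ξ : H) : hE.cutoff n (hE.cutoff n ξ) = hE.cutoff n ξ := by
  have h : (-n : ℝ) ≤ n := neg_le_self n.cast_nonneg
  simp only [cutoff_apply, map_sub, hE.apply_apply, min_self, min_eq_left h, min_eq_right h]
  abel

lemma inner_cutoff_left (n : ℕ) (ξ η : H) :
    (inner ℂ (hE.cutoff n ξ) η : ℂ) = inner ℂ ξ (hE.cutoff n η) := by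
  simp only [cutoff_apply, inner_sub_left, inner_sub_right, hE.inner_apply_left]

lemma norm_cutoff_le (n : ℕ) (ξ : H) : ‖hE.cutoff n ξ‖ ≤ ‖ξ‖ := by
  have h1 : ‖hE.cutoff n ξ‖ * ‖hE.cutoff n ξ‖ ≤ ‖ξ‖ * ‖hE.cutoff n ξ‖ := by
    rw [← inner_self_eq_norm_mul_norm (𝕜 := ℂ), hE.inner_cutoff_left, hE.cutoff_cutoff]
    exact (RCLike.re_le_norm _).trans (norm_inner_le_norm _ _)
  by_contra! h
  nlinarith [norm_nonneg ξ]

/-- The cutoff commutes with every step operator and is idempotent; pass to the strong limit. -/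
lemma cutoff_opFun (n : ℕ) (ξ : H) :
    hE.cutoff n (hE.opFun (hE.cutoff n ξ)) = hE.opFun (hE.cutoff n ξ) := by
  classical
  obtain ⟨c, hc⟩ := hE.exists_stepOp_tendsto {hE.cutoff n ξ} (by simp [hE.memDomain_cutoff n ξ])
  have h := hc _ (Finset.mem_singleton_self _)
  refine tendsto_nhds_unique (((hE.cutoff n).continuous.tendsto _).comp h) ?_
  refine h.congr fun k => ?_
  rw [Function.comp_apply, cutoff_apply hE n (hE.stepOp _ _), hE.apply_stepOp, hE.apply_stepOp,
    ← map_sub, ← hE.cutoff_apply, hE.cutoff_cutoff]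

lemma dense_op_domain : Dense (hE.op.domain : Set H) := fun ξ =>
  mem_closure_of_tendsto (hE.tendsto_cutoff ξ) (Eventually.of_forall fun n =>
    hE.memDomain_cutoff n ξ)

lemma op_isFormalAdjoint : hE.op.IsFormalAdjoint hE.op := fun ξ η =>
  inner_opFun_left ξ.2 η.2

/-- By the isometry, `‖hE.opFun (hE.cutoff n ξ)‖²` is the integral of `l²` over `(-n, n]` against
`hE.measure ξ`; let `n → ∞`. -/
lemma memDomain_of_forall_norm_le {ξ : H} {C : ℝ}
    (h : ∀ n, ‖hE.opFun (hE.cutoff n ξ)‖ ≤ C) : hE.MemDomain ξ := by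
  rw [memDomain_iff]
  have hm : Monotone fun n : ℕ => Set.Ioc (-n : ℝ) n := fun m n hmn =>
    Set.Ioc_subset_Ioc (neg_le_neg (Nat.cast_le.2 hmn)) (Nat.cast_le.2 hmn)
  have hU : ⋃ n : ℕ, Set.Ioc (-n : ℝ) n = Set.univ := Set.iUnion_eq_univ_iff.2 fun x => by
    obtain ⟨n, hn⟩ := exists_nat_gt |x|
    exact ⟨n, (abs_lt.1 hn).1, (abs_lt.1 hn).2.le⟩
  -- Continuity from below of the measure with density `l²` serves as monotone convergence.
  rw [← setLIntegral_univ, ← withDensity_apply _ MeasurableSet.univ, ← hU, hm.measure_iUnion]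
  refine (iSup_le fun n => ?_).trans_lt (ENNReal.ofReal_lt_top (r := C ^ 2))
  rw [withDensity_apply _ measurableSet_Ioc, ← hE.measure_cutoff,
    ← (hE.memDomain_cutoff n ξ).norm_opFun_sq]
  gcongr
  exact h n

/-- With `A` the operator and `P` a cutoff, moving `P` across the inner product gives `P A* η = A P
η`. So `‖A P η‖ ≤ ‖A* η‖` uniformly in the cutoff. -/
lemma adjoint_op_domain_le : (LinearPMap.adjoint hE.op).domain ≤ hE.op.domain := by
  intro η hη
  have hdual : ∀ x : hE.op.domain, (inner ℂ (LinearPMap.adjoint hE.op ⟨η, hη⟩) (x : H) : ℂ)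
      = inner ℂ η (hE.op x) := fun x =>
    LinearPMap.adjoint_isFormalAdjoint hE.dense_op_domain ⟨η, hη⟩ x
  refine hE.memDomain_of_forall_norm_le (C := ‖LinearPMap.adjoint hE.op ⟨η, hη⟩‖) fun n => ?_
  have key : hE.cutoff n (LinearPMap.adjoint hE.op ⟨η, hη⟩) = hE.opFun (hE.cutoff n η) := by
    refine ext_inner_right ℂ fun x => ?_
    have hx := hE.memDomain_cutoff n x
    rw [hE.inner_cutoff_left, hdual ⟨hE.cutoff n x, hx⟩, op_apply, ← hE.cutoff_opFun n x,
      ← hE.inner_cutoff_left, ← inner_opFun_left (hE.memDomain_cutoff n η) hx,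
      ← hE.inner_cutoff_left, hE.cutoff_opFun]
  rw [← key]
  exact hE.norm_cutoff_le n _

lemma isSelfAdjoint_op : LinearPMap.adjoint hE.op = hE.op := by
  have hle := LinearPMap.IsFormalAdjoint.le_adjoint hE.dense_op_domain hE.op_isFormalAdjoint
  exact (LinearPMap.eq_of_le_of_domain_eq hle (le_antisymm hle.1 hE.adjoint_op_domain_le)).symm

lemma isClosed_op : hE.op.IsClosed :=
  hE.isSelfAdjoint_op ▸ LinearPMap.adjoint_isClosed hE.dense_op_domain

/-! ### Transfer to `Φ` and the main theorem. -/

lemma resolutionForm_eq (ξ η : H) : resolutionForm E ξ η = fun l => inner ℂ η (E l ξ) := by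
  funext l
  rw [resolutionForm, hE.resolutionAbs_eq]

lemma resolutionQuadForm_eq (ξ : H) : resolutionQuadForm E ξ = fun l => ‖E l ξ‖ ^ 2 := by
  funext l
  rw [resolutionQuadForm, resolutionForm, hE.resolutionAbs_eq, hE.inner_apply_self,
    Complex.ofReal_re]

lemma monotone_resolutionQuadForm (ξ : H) : Monotone (resolutionQuadForm E ξ) := by
  rw [hE.resolutionQuadForm_eq]
  exact hE.monotone_norm_sq ξ

lemma measure_eq (ξ : H) :
    (hE.monotone_resolutionQuadForm ξ).stieltjesFunction.measure = hE.measure ξ := by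
  have h := hE.resolutionQuadForm_eq ξ
  rw [measure]
  congr! 2

lemma boundedVariationOn_resolutionForm (ξ η : H) :
    BoundedVariationOn (resolutionForm E ξ η) Set.univ := by
  rw [hE.resolutionForm_eq]
  exact hE.boundedVariationOn ξ η

lemma vectorMeasure_resolutionForm (ξ η : H) :
    (hE.boundedVariationOn_resolutionForm ξ η).vectorMeasure
      = (hE.boundedVariationOn ξ η).vectorMeasure := by
  have h := hE.resolutionForm_eq ξ η
  congr!

end IsSpectralFamily

/-- The first two existential quantifiers range over proofs: they assert that `l ↦ ⟨Φ(l) ξ, ξ⟩` is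
increasing and that `l ↦ ⟨Φ(l) ξ, η⟩` has bounded variation, so that their Lebesgue-Stieltjes
measures, against which one integrates below, are defined. -/
theorem mainTheorem6 {H : Type*} [NormedAddCommGroup H] [InnerProductSpace ℂ H] [CompleteSpace H]
    (X : ℝ → H →L[ℂ] H) (hX : IsStarResolutionOfIdentity X) (hγ : resolutionBound X = 1) :
    ∃ (hmono : ∀ ξ : H, Monotone (resolutionQuadForm X ξ))
      (hbv : ∀ ξ η : H, BoundedVariationOn (resolutionForm X ξ η) Set.univ),
      ∃! S : H →ₗ.[ℂ] H,
        (S.domain : Set H) =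
          {ξ : H | ∫⁻ l : ℝ, ENNReal.ofReal (l ^ 2) ∂(hmono ξ).stieltjesFunction.measure < ∞} ∧
        Dense (S.domain : Set H) ∧
        S.IsClosed ∧
        (∀ ξ η : S.domain, (inner ℂ (S ξ) (η : H) : ℂ) = inner ℂ (ξ : H) (S η)) ∧
        ∀ (ξ : S.domain) (η : H),
          Integrable (fun l : ℝ => l) (hbv ξ η).vectorMeasure.variation ∧
          (inner ℂ η (S ξ) : ℂ) = ∫ᵛ l : ℝ, l ∂•(hbv ξ η).vectorMeasure := by
  have hE := hX.resolution.isSpectralFamily hγ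
  have hdom : (hE.op.domain : Set H) = {ξ : H | ∫⁻ l : ℝ, ENNReal.ofReal (l ^ 2)
      ∂(hE.monotone_resolutionQuadForm ξ).stieltjesFunction.measure < ∞} := by
    ext ξ
    rw [Set.mem_ofPred_eq, hE.measure_eq]
    exact IsSpectralFamily.memDomain_iff
  have hint : ∀ (ξ : hE.op.domain) (η : H),
      Integrable (fun l : ℝ => l)
        (hE.boundedVariationOn_resolutionForm ξ η).vectorMeasure.variation ∧
      (inner ℂ η (hE.op ξ) : ℂ)
        = ∫ᵛ l : ℝ, l ∂•(hE.boundedVariationOn_resolutionForm ξ η).vectorMeasure := by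
    intro ξ η
    have hξ : hE.MemDomain ξ := ξ.2
    rw [hE.vectorMeasure_resolutionForm]
    exact ⟨hξ.integrable η, hξ.inner_opFun η⟩
  refine ⟨hE.monotone_resolutionQuadForm, hE.boundedVariationOn_resolutionForm, hE.op,
    ⟨hdom, hE.dense_op_domain, hE.isClosed_op, fun ξ η =>
      IsSpectralFamily.inner_opFun_left ξ.2 η.2, hint⟩, ?_⟩
  -- Uniqueness needs only the prescribed domain and the weak formula, which fixes every inner
  -- product with `T ξ`.
  rintro T ⟨hTdom, -, -, -, hT⟩
  refine LinearPMap.ext (SetLike.coe_injective (hTdom.trans hdom.symm)) fun ξ h1 h2 => ?_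
  refine ext_inner_left ℂ fun η => ?_
  rw [(hT ⟨ξ, h1⟩ η).2, (hint ⟨ξ, h2⟩ η).2]
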